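/- Let $\mathbb K$ be a field of characteristic zero. For formal power series $d=\sum_{n\ge 0}d_nx^n$ and $h=\sum_{n\ge 1}h_nx^n$ over $\mathbb K$ with $d_0\ne 0$ and $h_1\neq 0$, the Riordan matrix $(d,h)$ is the infinite lower triangular matrix $(d_{i,j})_{i,j\ge 0}$ with $d_{i,j}=[x^i]\,d(x)h(x)^j$. Let $\Omega_0$ be the set of Riordan matrices of the form $T(f\mid g)=\left([x^i]\,\frac{x^jf(x)}{g(x)^{j+1}}\right)_{i,j\ge 0}$, where $f,g\in\mathbb K[[x]]$ have nonzero constant terms and the coefficient $g_2$ of $x^2$ in $g$ is zero. A Riordan involution is a Riordan matrix whose square is the identity matrix $I$; it is nontrivial if it differs from $I$ and $-I$. For $\alpha=\sum_{i\ge 0}\alpha_ix^i\in\mathbb K[[x]]$, let $\mathcal I^+_\alpha$ denote the unique nontrivial Riordan involution $(d_{i,j})$ with $d_{0,0}=1$, $d_{2i+1,0}=\alpha_{2i}$ and $d_{2i+2,1}=\alpha_{2i+1}$ for all $i\ge 0$. Theorem. Let $d=\sum_{n\ge 0}d_nx^n$ and $h=\sum_{n\ge 1}h_nx^n$ be power series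 over $\mathbb K$ with $d_0=1$ and $h_1=-1$. Then $(d,h)\in\Omega_0$ if and only if $h_2^2=h_1h_3$; and if $(d,h)\in\Omega_0$, then there are $\alpha,\beta,\gamma\in\mathbb K[[x]]$ and three Riordan involutions $\mathcal I^+_\alpha=(\delta_1,\omega_1)$, $\mathcal I^+_\beta=(\delta_2,\omega_2)$, $\mathcal I^+_\gamma=(\delta_3,\omega_3)$ such that $$(d,h)=(\delta_1,\omega_1)(\delta_2,\omega_2)(\delta_3,\omega_3).$$ -/

import Mathlib

open PowerSeries

/-- The pair `(d, h)` of formal power series defines a Riordan matrix: `d` is invertible for the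
Cauchy product and `h` is invertible for composition. -/
def IsRiordanPair {K : Type*} [Field K] (d h : PowerSeries K) : Prop :=
  coeff 0 d ≠ 0 ∧ coeff 0 h = 0 ∧ coeff 1 h ≠ 0

/-- The infinite matrix `(d, h)`, with entries `d_{i,j} = [x^i] d(x) h(x)^j`. -/
noncomputable def riordanMatrix {K : Type*} [Field K] (d h : PowerSeries K) : Matrix ℕ ℕ K :=
  fun i j => coeff i (d * h ^ j)

/-- The infinite matrix `T(f ∣ g)`, with entries `d_{i,j} = [x^i] x^j f(x) / g(x)^(j+1)`. -/
noncomputable def riordanT {K : Type*} [Field K] (f g : PowerSeries K) : Matrix ℕ ℕ K :=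
  fun i j => coeff i (X ^ j * f * (g⁻¹) ^ (j + 1))

/-- An infinite matrix is a Riordan matrix if it is `(d, h)` for an admissible pair. -/
def IsRiordan {K : Type*} [Field K] (D : Matrix ℕ ℕ K) : Prop :=
  ∃ d h : PowerSeries K, IsRiordanPair d h ∧ D = riordanMatrix d h

/-- The row-by-column product of infinite lower triangular matrices: row `i` of `A` vanishes
beyond column `i`, so that the sum over all `k` reduces to `k ≤ i`. -/
def lowerMul {K : Type*} [Field K] (A B : Matrix ℕ ℕ K) : Matrix ℕ ℕ K :=
  fun i j => ∑ k ∈ Finset.range (i + 1), A i k * B k j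

/-- The set `Ω₀` of the Riordan matrices `T(f ∣ g)` (with `f`, `g` invertible for the Cauchy
product) such that `g_2 = 0`. -/
def Omega0 (K : Type*) [Field K] : Set (Matrix ℕ ℕ K) :=
  {D | ∃ f g : PowerSeries K, coeff 0 f ≠ 0 ∧ coeff 0 g ≠ 0 ∧ coeff 2 g = 0 ∧ D = riordanT f g}

/-- `D` is a Riordan involution: a Riordan matrix whose square is the identity,
and which is nontrivial, that is, different from `I` and `-I`. -/
structure IsNontrivialRiordanInvolution {K : Type*} [Field K] (D : Matrix ℕ ℕ K) : Prop where
  isRiordan : IsRiordan D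
  mul_self : lowerMul D D = 1
  ne_one : D ≠ 1
  ne_neg_one : D ≠ -1

/-- `D` is the involution `I⁺_α`: the nontrivial Riordan involution with `d_{0,0} = 1`,
`d_{2i+1,0} = α_{2i}` and `d_{2i+2,1} = α_{2i+1}` for all `i`. -/
structure IsPlusInvolution {K : Type*} [Field K] (α : PowerSeries K) (D : Matrix ℕ ℕ K) :
    Prop where
  isInvolution : IsNontrivialRiordanInvolution D
  zero_zero : D 0 0 = 1
  col_zero : ∀ i : ℕ, D (2 * i + 1) 0 = coeff (2 * i) α
  col_one : ∀ i : ℕ, D (2 * i + 2) 1 = coeff (2 * i + 1) α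

/-! Write `g = X / h`; membership in `Omega0` says `g₂ = 0`, and inverting the series turns this
into `h₂² = h₁h₃`. For the factorization, multiply `T = (d, h)` on the left by an involution `A`
with argument `-x/(1 - bx)`. Suitable `b` and weight give `A * T = (e, k)` with `e = 1 + O(x²)` and
`x/k = 1 - x + O(x³)`; the absent `x²` term is exactly `g₂ = 0`.

Such a pair is conjugate to `M = (1, x/(1 - x))` (`exists_conj_negX`): in the coordinate `1/x`, `M`
is translation by `-1`, and conjugating `k` to it is an Abel equation, solved coefficientwise in
characteristic zero (`exists_mul_subst_sub_eq`). Since `M = (1, -x)(1, -x/(1 + x))` is a product of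
two involutions, so is its conjugate `A * T`, and `T = A * (A * T)`. -/

/-! ### Riordan products as weighted substitution -/

section Substitution

variable {K : Type*} [Field K]

lemma coeff_pow_eq_zero_of_lt {k : PowerSeries K} (hk : constantCoeff k = 0) {i j : ℕ}
    (hij : i < j) : coeff i (k ^ j) = 0 :=
  X_pow_dvd_iff.mp (pow_dvd_pow_of_dvd (X_dvd_iff.mpr hk) j) i hij

/-- The fundamental theorem of Riordan matrices. -/
lemma coeff_mul_subst {k : PowerSeries K} (hk : constantCoeff k = 0) (c f : PowerSeries K)
    (n : ℕ) :
    coeff n (c * f.subst k) = ∑ j ∈ Finset.range (n + 1), coeff j f * coeff n (c * k ^ j) := by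
  have key : ∀ m ≤ n, coeff m (f.subst k) =
      ∑ j ∈ Finset.range (n + 1), coeff j f * coeff m (k ^ j) := by
    intro m hm
    rw [coeff_subst' (HasSubst.of_constantCoeff_zero' hk)]
    simp only [smul_eq_mul]
    refine finsum_eq_sum_of_support_subset _ fun j hj => ?_
    by_contra hjn
    simp only [Finset.coe_range, Set.mem_Iio, not_lt] at hjn
    exact hj (by simp [coeff_pow_eq_zero_of_lt hk (show m < j by omega)])
  rw [coeff_mul]
  calc _ = ∑ p ∈ Finset.HasAntidiagonal.antidiagonal n, ∑ j ∈ Finset.range (n + 1),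
        coeff j f * (coeff p.1 c * coeff p.2 (k ^ j)) := by
        refine Finset.sum_congr rfl fun p hp => ?_
        rw [key p.2 (by have := Finset.HasAntidiagonal.mem_antidiagonal.mp hp; omega), Finset.mul_sum]
        exact Finset.sum_congr rfl fun j _ => by ring
    _ = _ := by
        rw [Finset.sum_comm]
        exact Finset.sum_congr rfl fun j _ => by rw [coeff_mul, Finset.mul_sum]

lemma lowerMul_riordanMatrix {h : PowerSeries K} (hh : constantCoeff h = 0)
    (d d' h' : PowerSeries K) :
    lowerMul (riordanMatrix d h) (riordanMatrix d' h') =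
      riordanMatrix (d * d'.subst h) (h'.subst h) := by
  ext i j
  have hs := HasSubst.of_constantCoeff_zero' hh
  simp only [lowerMul, riordanMatrix]
  rw [mul_assoc, ← subst_pow hs, ← subst_mul hs, coeff_mul_subst hh]
  exact Finset.sum_congr rfl fun _ _ => mul_comm _ _

lemma riordanMatrix_one_X : riordanMatrix (1 : PowerSeries K) X = 1 := by
  ext i j
  simp [riordanMatrix, coeff_X_pow, Matrix.one_apply]

lemma constantCoeff_subst_of_constantCoeff_eq_zero {k : PowerSeries K}
    (hk : constantCoeff k = 0) (f : PowerSeries K) :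
    constantCoeff (f.subst k) = constantCoeff f := by
  have := coeff_mul_subst hk 1 f 0
  simpa using this

lemma coeff_one_subst_of_constantCoeff_eq_zero {k : PowerSeries K}
    (hk : constantCoeff k = 0) (f : PowerSeries K) :
    coeff 1 (f.subst k) = coeff 1 f * coeff 1 k := by
  have := coeff_mul_subst hk 1 f 1
  simpa [Finset.sum_range_succ, coeff_one] using this

lemma subst_one_eq_one {k : PowerSeries K} (hk : constantCoeff k = 0) :
    (1 : PowerSeries K).subst k = 1 := by
  rw [← coe_substAlgHom (HasSubst.of_constantCoeff_zero' hk), map_one]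

end Substitution

/-! ### Linear functional equations for a substitution tangent to the identity -/

section LinearEquation

variable {K : Type*} [Field K]

/-- The solution `u` of the triangular system `∑ j ≤ n, u j * B n j = F n`. -/
noncomputable def triangularSolution (B : ℕ → ℕ → K) (F : ℕ → K) : ℕ → K
  | n => (F n - ∑ j : Fin n, triangularSolution B F j * B n j) / B n n
decreasing_by exact j.2

lemma sum_triangularSolution_mul (B : ℕ → ℕ → K) (F : ℕ → K) {n : ℕ} (hB : B n n ≠ 0) :
    ∑ j ∈ Finset.range (n + 1), triangularSolution B F j * B n j = F n := by
  rw [Finset.sum_range_succ,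
    ← Fin.sum_univ_eq_sum_range (fun j => triangularSolution B F j * B n j)]
  conv_lhs => enter [2]; rw [triangularSolution]
  rw [div_mul_cancel₀ _ hB]
  ring

/-- In degree `n + 1` the coefficient `W_{n+1}` cancels and `W_n` appears with factor `c₁ + n q₁ = n
+ 1`, so the system is triangular with nonzero diagonal. -/
lemma exists_mul_subst_sub_eq_X_mul [CharZero K] {c q : PowerSeries K}
    (hc0 : constantCoeff c = 1) (hc1 : coeff 1 c = 1)
    (hq0 : constantCoeff q = 1) (hq1 : coeff 1 q = 1) (s : PowerSeries K) :
    ∃ W : PowerSeries K, c * W.subst (X * q) - W = X * s := by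
  have hk : constantCoeff (X * q) = 0 := by simp
  let B : ℕ → ℕ → K := fun n j => coeff (n + 1) (c * (X * q) ^ j - X ^ j)
  have hcq (n j : ℕ) : coeff (n + j) (c * (X * q) ^ j) = coeff n (c * q ^ j) := by
    rw [mul_pow, mul_left_comm, coeff_X_pow_mul]
  have hB (n : ℕ) : B n n = n + 1 := by
    have := hcq 1 n
    simp only [B, map_sub, add_comm n 1, this]
    simp [coeff_one_mul, coeff_one_pow, hc0, hc1, hq0, hq1, coeff_X_pow, add_comm]
  refine ⟨PowerSeries.mk (triangularSolution B fun n => coeff n s), ?_⟩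
  ext n
  cases n with
  | zero => simp [hc0, constantCoeff_subst_of_constantCoeff_eq_zero hk]
  | succ n =>
    have hdiag : coeff (n + 1) (c * (X * q) ^ (n + 1)) = 1 := by
      simpa [hc0, hq0] using hcq 0 (n + 1)
    rw [coeff_succ_X_mul, map_sub, coeff_mul_subst hk, Finset.sum_range_succ, hdiag, mul_one,
      add_sub_cancel_right,
      ← sum_triangularSolution_mul B (fun n => coeff n s) (n := n)
        (by rw [hB]; exact n.cast_add_one_ne_zero)]
    refine Finset.sum_congr rfl fun j hj => ?_
    have : n + 1 ≠ j := by have := Finset.mem_range.mp hj; omega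
    simp [B, coeff_X_pow, this]

/-- Putting `U = X * W` turns the weight `e` into `e * q`, whose linear coefficient is 1, and
removes one factor `X` from the equation. -/
lemma exists_mul_subst_sub_eq [CharZero K] {e q : PowerSeries K}
    (he0 : constantCoeff e = 1) (he1 : coeff 1 e = 0)
    (hq0 : constantCoeff q = 1) (hq1 : coeff 1 q = 1) {F : PowerSeries K} (hF : X ^ 2 ∣ F) :
    ∃ U : PowerSeries K, constantCoeff U = 0 ∧ e * U.subst (X * q) - U = F := by
  obtain ⟨s, rfl⟩ := hF
  obtain ⟨W, hW⟩ := exists_mul_subst_sub_eq_X_mul (c := e * q) (q := q) (by simp [he0, hq0])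
    (by simp [coeff_one_mul, he0, he1, hq0, hq1]) hq0 hq1 s
  have hk := HasSubst.of_constantCoeff_zero' (show constantCoeff (X * q) = 0 by simp)
  refine ⟨X * W, by simp, ?_⟩
  rw [subst_mul hk, subst_X hk]
  linear_combination X * hW

end LinearEquation

/-- Pairs `(d, h)` with `h` of positive order, under the Riordan product. -/
@[ext]
structure SubstPair (K : Type*) [Field K] where
  weight : PowerSeries K
  arg : PowerSeries K
  constantCoeff_arg : constantCoeff arg = 0

/-! ### The monoid of pairs and its involutions -/

namespace SubstPair

variable {K : Type*} [Field K]

lemma hasSubst (A : SubstPair K) : HasSubst A.arg :=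
  HasSubst.of_constantCoeff_zero' A.constantCoeff_arg

noncomputable instance : Monoid (SubstPair K) where
  mul A B := ⟨A.weight * B.weight.subst A.arg, B.arg.subst A.arg, by
    rw [constantCoeff_subst_of_constantCoeff_eq_zero A.constantCoeff_arg, B.constantCoeff_arg]⟩
  one := ⟨1, X, by simp⟩
  mul_assoc A B C := by
    have h := subst_comp_subst_apply (R := K) B.hasSubst A.hasSubst
    refine SubstPair.ext ?_ ?_
    · change A.weight * B.weight.subst A.arg * C.weight.subst (B.arg.subst A.arg) =
        A.weight * (B.weight * C.weight.subst B.arg).subst A.arg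
      rw [subst_mul A.hasSubst, h, mul_assoc]
    · exact (h C.arg).symm
  one_mul A := by
    refine SubstPair.ext ?_ ?_
    · change 1 * A.weight.subst X = A.weight
      rw [X_subst, one_mul]
    · exact X_subst A.arg
  mul_one A := by
    refine SubstPair.ext ?_ ?_
    · change A.weight * (1 : PowerSeries K).subst A.arg = A.weight
      rw [subst_one_eq_one A.constantCoeff_arg, mul_one]
    · exact subst_X A.hasSubst

@[simp] lemma mul_weight (A B : SubstPair K) :
    (A * B).weight = A.weight * B.weight.subst A.arg := rfl

@[simp] lemma mul_arg (A B : SubstPair K) : (A * B).arg = B.arg.subst A.arg := rfl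

@[simp] lemma one_weight : (1 : SubstPair K).weight = 1 := rfl

@[simp] lemma one_arg : (1 : SubstPair K).arg = X := rfl

/-- The Riordan matrix of a pair. -/
noncomputable def toMatrix (A : SubstPair K) : Matrix ℕ ℕ K := riordanMatrix A.weight A.arg

lemma toMatrix_mul (A B : SubstPair K) : (A * B).toMatrix = lowerMul A.toMatrix B.toMatrix :=
  (lowerMul_riordanMatrix A.constantCoeff_arg _ _ _).symm

lemma toMatrix_one : (1 : SubstPair K).toMatrix = 1 := riordanMatrix_one_X

/-- The two leading diagonal entries, as a homomorphism. -/
noncomputable def leading : SubstPair K →* K × K where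
  toFun A := (constantCoeff A.weight, coeff 1 A.arg)
  map_one' := by simp
  map_mul' A B := by
    simp [constantCoeff_subst_of_constantCoeff_eq_zero A.constantCoeff_arg,
      coeff_one_subst_of_constantCoeff_eq_zero A.constantCoeff_arg, mul_comm]

lemma leading_apply (A : SubstPair K) :
    leading A = (constantCoeff A.weight, coeff 1 A.arg) := rfl

lemma isRiordanPair_of_leading {A : SubstPair K} (hA : leading A = (1, -1)) :
    IsRiordanPair A.weight A.arg := by
  simp only [leading_apply, Prod.mk.injEq] at hA
  simp [IsRiordanPair, hA, A.constantCoeff_arg]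

/-- The series recording the free entries of the first two columns of a matrix. -/
noncomputable def freeEntries (D : Matrix ℕ ℕ K) : PowerSeries K :=
  PowerSeries.mk fun n => if Even n then D (n + 1) 0 else D (n + 1) 1

/-- Diagonal entries 1 and -1 exclude both `I` and `-I`; the series α is simply read off the matrix.
-/
lemma isPlusInvolution_of_mul_self [CharZero K] {A : SubstPair K} (hA : leading A = (1, -1))
    (hAA : A * A = 1) : IsPlusInvolution (freeEntries A.toMatrix) A.toMatrix := by
  have h0 : A.toMatrix 0 0 = 1 := by
    simp only [leading_apply, Prod.mk.injEq] at hA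
    simp [toMatrix, riordanMatrix, hA]
  have h1 : A.toMatrix 1 1 = -1 := by
    simp only [leading_apply, Prod.mk.injEq] at hA
    simp [toMatrix, riordanMatrix, coeff_one_mul, hA, A.constantCoeff_arg]
  refine ⟨⟨⟨_, _, isRiordanPair_of_leading hA, rfl⟩, ?_, ?_, ?_⟩, h0, ?_, ?_⟩
  · rw [← toMatrix_mul, hAA, toMatrix_one]
  · intro h
    rw [h] at h1
    norm_num at h1
  · intro h
    rw [h] at h0
    norm_num at h0
  · intro i
    simp [freeEntries]
  · intro i
    simp [freeEntries]

lemma exists_inverse {A : SubstPair K} (h0 : constantCoeff A.weight ≠ 0)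
    (h1 : coeff 1 A.arg ≠ 0) : ∃ B : SubstPair K, A * B = 1 ∧ B * A = 1 := by
  obtain ⟨p, hp, hl, hr⟩ : ∃ p : PowerSeries K, constantCoeff p = 0 ∧
      p.subst A.arg = X ∧ A.arg.subst p = X :=
    ⟨A.arg.substInvOfIsUnit h1.isUnit, constantCoeff_substInvOfIsUnit _ _,
      subst_substInvOfIsUnit_left _ A.constantCoeff_arg _,
      subst_substInvOfIsUnit_right _ A.constantCoeff_arg _⟩
  have hps := HasSubst.of_constantCoeff_zero' hp
  have hu : constantCoeff (A.weight.subst p) ≠ 0 := by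
    rwa [constantCoeff_subst_of_constantCoeff_eq_zero hp]
  refine ⟨⟨(A.weight.subst p)⁻¹, p, hp⟩, SubstPair.ext ?_ hl, SubstPair.ext ?_ hr⟩
  · have hw : subst A.arg (subst p A.weight : PowerSeries K) = A.weight := by
      rw [PowerSeries.subst_comp_subst_apply hps A.hasSubst, hl, X_subst]
    rw [mul_weight, one_weight]
    conv_lhs => enter [1]; rw [← hw]
    rw [← PowerSeries.subst_mul A.hasSubst, PowerSeries.mul_inv_cancel _ hu,
      subst_one_eq_one A.constantCoeff_arg]
  · exact PowerSeries.inv_mul_cancel _ hu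

end SubstPair

/-! ### Membership in `Omega0` through `g = X / h` -/

section Omega

variable {K : Type*} [Field K]

/-- The relation `h * g = X` expresses `(d, h) = T(d g ∣ g)`. -/
lemma riordanMatrix_mem_Omega0_iff {d h : PowerSeries K} (hd0 : coeff 0 d = 1) :
    riordanMatrix d h ∈ Omega0 K ↔
      ∃ g : PowerSeries K, coeff 0 g ≠ 0 ∧ coeff 2 g = 0 ∧ h * g = X := by
  constructor
  · rintro ⟨f, g, -, hg, hg2, hD⟩
    refine ⟨g, hg, hg2, ?_⟩
    have hgi : g⁻¹ * g = 1 := PowerSeries.inv_mul_cancel _ (by simpa using hg)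
    have hcol (j : ℕ) : d * h ^ j = X ^ j * f * g⁻¹ ^ (j + 1) := by
      ext i
      exact congrFun (congrFun hD i) j
    have h0 : d = f * g⁻¹ := by simpa using hcol 0
    have h1 : d * h = X * f * g⁻¹ ^ 2 := by simpa using hcol 1
    have hd : d ≠ 0 := by
      rintro rfl
      simp at hd0
    refine mul_left_cancel₀ hd ?_
    linear_combination g * h1 - X * h0 + X * f * g⁻¹ * hgi
  · rintro ⟨g, hg, hg2, hgh⟩
    have hgi : g * g⁻¹ = 1 := PowerSeries.mul_inv_cancel _ (by simpa using hg)
    have hh : h = X * g⁻¹ := by linear_combination g⁻¹ * hgh - h * hgi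
    have hd0' : constantCoeff d = 1 := by simpa using hd0
    refine ⟨d * g, g, by simpa [hd0'] using hg, hg, hg2, ?_⟩
    ext i j
    simp only [riordanMatrix, riordanT]
    congr 1
    rw [hh]
    linear_combination -(d * X ^ j * g⁻¹ ^ j) * hgi

lemma exists_mul_eq_X {h : PowerSeries K} (hh0 : coeff 0 h = 0) (hh1 : coeff 1 h ≠ 0) :
    ∃ g : PowerSeries K, coeff 0 g ≠ 0 ∧ h * g = X := by
  obtain ⟨q, rfl⟩ := X_dvd_iff.mpr (by simpa using hh0)
  have hq : constantCoeff q ≠ 0 := by simpa using hh1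
  exact ⟨q⁻¹, by simpa using hq, by rw [mul_assoc, PowerSeries.mul_inv_cancel _ hq, mul_one]⟩

lemma coeffs_of_mul_eq_X {h g : PowerSeries K} (hh0 : coeff 0 h = 0) (hh1 : coeff 1 h = -1)
    (hhg : h * g = X) :
    coeff 0 g = -1 ∧ coeff 1 g = -coeff 2 h ∧ coeff 2 g = -(coeff 2 h ^ 2 + coeff 3 h) := by
  obtain ⟨q, rfl⟩ := X_dvd_iff.mpr (by simpa using hh0)
  have hc (n : ℕ) : coeff (n + 1) (X * q) = coeff n q := coeff_succ_X_mul n q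
  have hqg : q * g = 1 := mul_left_cancel₀ X_ne_zero (by linear_combination hhg)
  rw [hc 0] at hh1
  rw [hc 1, hc 2]
  have e0 := congrArg (coeff 0) hqg
  have e1 := congrArg (coeff 1) hqg
  have e2 := congrArg (coeff 2) hqg
  simp only [coeff_mul, Finset.Nat.antidiagonal_succ, Finset.Nat.antidiagonal_zero,
    Finset.map_singleton, Finset.sum_cons, Finset.sum_singleton, coeff_one, Finset.map_cons,
    Function.Embedding.prodMap, Function.Embedding.coeFn_mk, Prod.map, Nat.succ_eq_add_one,
    Function.Embedding.refl_apply] at e0 e1 e2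
  norm_num [hh1] at e0 e1 e2
  simp only [coeff_zero_eq_constantCoeff] at *
  have g0 : constantCoeff g = -1 := by linear_combination -e0
  have g1 : coeff 1 g = -coeff 1 q := by rw [g0] at e1; linear_combination -e1
  refine ⟨g0, g1, ?_⟩
  rw [g0, g1] at e2
  linear_combination -e2

lemma riordanMatrix_mem_Omega0_iff_coeff {d h : PowerSeries K} (hd0 : coeff 0 d = 1)
    (hh0 : coeff 0 h = 0) (hh1 : coeff 1 h = -1) :
    riordanMatrix d h ∈ Omega0 K ↔ coeff 2 h ^ 2 = coeff 1 h * coeff 3 h := by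
  rw [riordanMatrix_mem_Omega0_iff hd0, hh1]
  constructor
  · rintro ⟨g, -, hg2, hhg⟩
    have := (coeffs_of_mul_eq_X hh0 hh1 hhg).2.2
    rw [hg2] at this
    linear_combination this
  · intro hc
    obtain ⟨g, hg, hhg⟩ := exists_mul_eq_X hh0 (by simp [hh1])
    refine ⟨g, hg, ?_, hhg⟩
    rw [(coeffs_of_mul_eq_X hh0 hh1 hhg).2.2]
    linear_combination -hc

lemma exists_eq_add_X_pow_three_mul (g : PowerSeries K) : ∃ s : PowerSeries K,
    g = C (coeff 0 g) + C (coeff 1 g) * X + C (coeff 2 g) * X ^ 2 + X ^ 3 * s := by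
  refine ⟨PowerSeries.mk fun n => coeff (n + 3) g, ?_⟩
  ext n
  rcases n with _ | _ | _ | n
  · simp
  · simp [coeff_X_pow_mul', coeff_C, coeff_X_pow]
  · simp [coeff_X_pow_mul', coeff_X_pow]
  · simp [coeff_X_pow_mul', coeff_X_pow]

end Omega

/-! ### Möbius involutions, conjugation and the factorization -/

namespace SubstPair

variable {K : Type*} [Field K]

/-- The involution `(1, -x)`. -/
noncomputable def negX : SubstPair K := ⟨1, -X, by simp⟩

lemma negX_mul_negX : (negX : SubstPair K) * negX = 1 := by
  refine SubstPair.ext ?_ ?_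
  · simp [negX, subst_one_eq_one]
  · have : HasSubst (-X : PowerSeries K) := negX.hasSubst
    simp only [negX, mul_arg, one_arg]
    rw [← coe_substAlgHom this, map_neg, coe_substAlgHom, subst_X this, neg_neg]

lemma leading_negX : leading (negX : SubstPair K) = (1, -1) := by
  simp [leading_apply, negX]

lemma subst_C_mul {k : PowerSeries K} (hk : constantCoeff k = 0) (b : K) (f : PowerSeries K) :
    (C b * f).subst k = C b * f.subst k := by
  rw [← smul_eq_C_mul, subst_smul (HasSubst.of_constantCoeff_zero' hk), smul_eq_C_mul]

lemma subst_one_sub_C_mul_X {k : PowerSeries K} (hk : constantCoeff k = 0) (b : K) :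
    (1 - C b * X).subst k = 1 - C b * k := by
  have hs := HasSubst.of_constantCoeff_zero' hk
  rw [subst_sub hs, subst_one_eq_one hk, subst_C_mul hk, subst_X hs]

/-- An involution of argument `-x / (1 - b x)` with prescribed linear term of its weight. -/
lemma exists_moebius_involution [CharZero K] (b a : K) : ∃ A : SubstPair K,
    leading A = (1, -1) ∧ A * A = 1 ∧ coeff 1 A.weight = a ∧
      (a = 0 → A.weight = 1) ∧ A.arg * (1 - C b * X) = -X := by
  have hinv (t : K) : (1 - C t * X) * (1 - C t * X)⁻¹ = 1 :=
    PowerSeries.mul_inv_cancel _ (by simp)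
  obtain ⟨P, hP⟩ : ∃ P : PowerSeries K, P = 1 - C b * X := ⟨_, rfl⟩
  have hPi : P * P⁻¹ = 1 := hP ▸ hinv b
  have hP0 : constantCoeff P = 1 := by simp [hP]
  have hP0i : constantCoeff P⁻¹ = 1 := by simp [hP0]
  have hw : constantCoeff (-X * P⁻¹) = 0 := by simp
  have hs := HasSubst.of_constantCoeff_zero' hw
  -- The weight will be `(1 - m x)/(1 - n x)`: `n - m = a` is its linear coefficient, and `m + n =
  -- b` makes the substitution invert it.
  set m := (b - a) / 2 with hm
  set n := (b + a) / 2 with hn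
  have hmn : b = m + n := by rw [hm, hn]; ring
  have hnm : n - m = a := by rw [hm, hn]; ring
  have hC : (C b : PowerSeries K) = C m + C n := by rw [hmn, map_add]
  obtain ⟨R, hR⟩ : ∃ R : PowerSeries K, R = (1 - C n * X)⁻¹ := ⟨_, rfl⟩
  have hRi : (1 - C n * X) * R = 1 := hR ▸ hinv n
  have hR0 : constantCoeff R = 1 := by simp [hR]
  have hR1 : coeff 1 R = n := by
    have := congrArg (coeff 1) hRi
    simp [coeff_one_mul, hR0, coeff_one] at this
    linear_combination this
  have hRs : (1 - C n * (-X * P⁻¹)) * R.subst (-X * P⁻¹) = 1 := by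
    rw [← subst_one_sub_C_mul_X hw, ← subst_mul hs, hRi, subst_one_eq_one hw]
  have hPs : (1 - C b * (-X * P⁻¹)) * P⁻¹.subst (-X * P⁻¹) = 1 := by
    rw [← subst_one_sub_C_mul_X hw, ← hP, ← subst_mul hs, hPi, subst_one_eq_one hw]
  -- Substitution swaps the two factors up to the common `P⁻¹`.
  have hm' : (1 - C m * (-X * P⁻¹)) = P⁻¹ * (1 - C n * X) := by
    have : P = 1 - C m * X - C n * X := by rw [hP, hC]; ring
    linear_combination -hPi + P⁻¹ * this
  have hn' : (1 - C n * (-X * P⁻¹)) = P⁻¹ * (1 - C m * X) := by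
    have : P = 1 - C m * X - C n * X := by rw [hP, hC]; ring
    linear_combination -hPi + P⁻¹ * this
  have hb' : (1 - C b * (-X * P⁻¹)) = P⁻¹ := by
    linear_combination -hPi + P⁻¹ * hP
  refine ⟨⟨(1 - C m * X) * R, -X * P⁻¹, hw⟩, ?_, SubstPair.ext ?_ ?_, ?_, ?_, ?_⟩
  · simp [leading_apply, hR0, hP0]
  · simp only [mul_weight, one_weight]
    rw [subst_mul hs, subst_one_sub_C_mul_X hw, hm']
    rw [hn'] at hRs
    linear_combination hRs * (1 - C n * X) * R + hRi
  · simp only [mul_arg, one_arg]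
    rw [subst_mul hs, ← coe_substAlgHom hs, map_neg, coe_substAlgHom, subst_X hs]
    rw [hb'] at hPs
    linear_combination X * hPs
  · simp only [coeff_one_mul, hR0, hR1]
    simp [coeff_one]
    linear_combination hnm
  · intro ha
    have : m = n := by rw [hm, hn, ha]; ring
    rw [this]
    exact hRi
  · rw [← hP]
    linear_combination -X * hPi

/-- A pair `(e, k)` with `e = 1 + O(x ^ 2)` and `x / k = 1 - x + O(x ^ 3)` is conjugate to
`(1, x / (1 - x))`. -/
lemma exists_conj_negX [CharZero K] {N : SubstPair K} {s : PowerSeries K}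
    (he0 : constantCoeff N.weight = 1) (he1 : coeff 1 N.weight = 0)
    (hk : N.arg * (1 - X + X ^ 3 * s) = X) {M : SubstPair K} (hM : M.weight = 1)
    (hMX : M.arg * (1 - X) = X) :
    ∃ A B : SubstPair K, A * B = 1 ∧ B * A = 1 ∧ N * A = A * M := by
  obtain ⟨e, k, hk0⟩ := N
  obtain ⟨w, m, hm0⟩ := M
  dsimp only at he0 he1 hk hM hMX
  subst hM
  obtain ⟨q, rfl⟩ := X_dvd_iff.mpr hk0
  have hqG : q * (1 - X + X ^ 3 * s) = 1 := mul_left_cancel₀ X_ne_zero (by linear_combination hk)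
  have hq0 : constantCoeff q = 1 := by
    simpa using congrArg constantCoeff hqG
  have hq1 : coeff 1 q = 1 := by
    have := congrArg (coeff 1) hqG
    simp [coeff_one_mul, hq0, coeff_one, coeff_X_pow] at this
    linear_combination this
  have hks := HasSubst.of_constantCoeff_zero' hk0
  -- The conjugator is `(1 + U, φ)`. Its weight must satisfy `e * (1 + U)(k) = 1 + U`.
  obtain ⟨U, hU0, hU⟩ := exists_mul_subst_sub_eq (F := 1 - e) he0 he1 hq0 hq1 (by
    rw [X_pow_dvd_iff]
    intro i hi
    interval_cases i
    · simp [he0]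
    · simp [he1, coeff_one])
  -- With `1/φ = 1/x + V` and `1/k = 1/x - 1 + x² s`, the equation `1/φ(k) = 1/φ - 1` becomes `V(k)
  -- - V = -x² s`.
  obtain ⟨V, hV0, hV⟩ := exists_mul_subst_sub_eq (e := 1) (F := -(X ^ 2 * s)) (by simp)
    (by simp [coeff_one]) hq0 hq1 (Dvd.intro _ rfl).neg_right
  obtain ⟨R, hR⟩ : ∃ R : PowerSeries K, R = (1 + X * V)⁻¹ := ⟨_, rfl⟩
  have hRi : (1 + X * V) * R = 1 := hR ▸ PowerSeries.mul_inv_cancel _ (by simp)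
  have hR0 : constantCoeff R = 1 := by simp [hR]
  have hφ0 : constantCoeff (X * R) = 0 := by simp
  have hφs := HasSubst.of_constantCoeff_zero' hφ0
  obtain ⟨B, hAB, hBA⟩ := exists_inverse (A := ⟨1 + U, X * R, hφ0⟩) (by simp [hU0])
    (by simp [hR0])
  refine ⟨_, B, hAB, hBA, SubstPair.ext ?_ ?_⟩
  · simp only [mul_weight, subst_one_eq_one hφ0]
    rw [subst_add hks, subst_one_eq_one hk0]
    linear_combination hU
  · simp only [mul_arg]
    have h1 : (1 + X * q * V.subst (X * q)) * R.subst (X * q) = 1 := by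
      have := congrArg (subst (X * q)) hRi
      rwa [subst_mul hks, subst_add hks, subst_mul hks, subst_one_eq_one hk0,
        subst_X hks] at this
    have h2 : m.subst (X * R) * (1 - X * R) = X * R := by
      have := congrArg (subst (X * R)) hMX
      rwa [subst_mul hφs, subst_sub hφs, subst_one_eq_one hφ0, subst_X hφs] at this
    rw [subst_mul hks, subst_X hks]
    have h3 : (1 - X + X * V) ≠ 0 := fun h => by
      have := congrArg constantCoeff h
      simp at this
    have hL : X * q * R.subst (X * q) * (1 - X + X * V) = X := by
      have : q * (1 - X + X * V) = 1 + X * q * V.subst (X * q) := by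
        linear_combination hqG - X * q * hV
      linear_combination X * h1 + X * R.subst (X * q) * this
    have hRR : m.subst (X * R) * (1 - X + X * V) = X := by
      linear_combination (1 + X * V) * h2 + (X + X * m.subst (X * R)) * hRi
    exact mul_right_cancel₀ h3 (hL.trans hRR.symm)

lemma exists_three_involutions [CharZero K] (T : SubstPair K) (hd0 : coeff 0 T.weight = 1)
    {g : PowerSeries K} (hg0 : coeff 0 g = -1) (hg2 : coeff 2 g = 0) (hTg : T.arg * g = X) :
    ∃ A B C : SubstPair K, leading A = (1, -1) ∧ leading B = (1, -1) ∧ leading C = (1, -1) ∧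
      A * A = 1 ∧ B * B = 1 ∧ C * C = 1 ∧ T = A * B * C := by
  -- Here `b = 1 + g₁` makes the linear coefficient of `x/k` equal to -1, and the weight's linear
  -- term `d₁` cancels the `-d₁` coming from `d(A.arg)`.
  obtain ⟨A, hA, hAA, hA1, -, hAX⟩ :=
    exists_moebius_involution (1 + coeff 1 g) (coeff 1 T.weight)
  obtain ⟨D, hD, hDD, -, hDw, hDX⟩ := exists_moebius_involution (-1 : K) 0
  obtain ⟨s, hs⟩ := exists_eq_add_X_pow_three_mul g
  obtain ⟨p, hp⟩ := X_dvd_iff.mpr A.constantCoeff_arg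
  have hA' := hA
  simp only [leading_apply, Prod.mk.injEq] at hA'
  have hTw : constantCoeff T.weight = 1 := by simpa using hd0
  have hMw : (negX * D).weight = 1 := by
    rw [mul_weight, hDw rfl, subst_one_eq_one negX.constantCoeff_arg]
    simp [negX]
  have hMX : (negX * D).arg * (1 - X) = X := by
    have hneg : (-X : PowerSeries K).subst (negX : SubstPair K).arg = X :=
      congrArg SubstPair.arg negX_mul_negX
    have := congrArg (PowerSeries.subst (negX : SubstPair K).arg) hDX
    rw [PowerSeries.subst_mul negX.hasSubst, subst_one_sub_C_mul_X negX.constantCoeff_arg,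
      hneg] at this
    simpa [negX, sub_eq_add_neg] using this
  have hgA : g.subst A.arg = -1 + C (coeff 1 g) * A.arg + A.arg ^ 3 * s.subst A.arg := by
    conv_lhs => rw [hs, hg0, hg2]
    have h1 := subst_C_mul A.constantCoeff_arg (-1) 1
    have h2 := subst_C_mul A.constantCoeff_arg (coeff 1 g) X
    rw [subst_one_eq_one A.constantCoeff_arg] at h1
    rw [PowerSeries.subst_X A.hasSubst] at h2
    simp only [map_zero, zero_mul, add_zero]
    rw [PowerSeries.subst_add A.hasSubst, PowerSeries.subst_add A.hasSubst, h2,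
      PowerSeries.subst_mul A.hasSubst, PowerSeries.subst_pow A.hasSubst,
      PowerSeries.subst_X A.hasSubst, ← mul_one (C (-1)), h1]
    simp
  have hTA : (A * T).arg * g.subst A.arg = A.arg := by
    rw [mul_arg, ← PowerSeries.subst_mul A.hasSubst, hTg, PowerSeries.subst_X A.hasSubst]
  obtain ⟨E, F, hEF, hFE, hNE⟩ := exists_conj_negX (N := A * T) (M := negX * D)
    (s := -(1 - C (1 + coeff 1 g) * X) * p ^ 3 * s.subst A.arg)
    (by simp [hA', hTw, constantCoeff_subst_of_constantCoeff_eq_zero A.constantCoeff_arg])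
    (by simp [coeff_one_mul, hA', hTw, hA1,
      constantCoeff_subst_of_constantCoeff_eq_zero A.constantCoeff_arg,
      coeff_one_subst_of_constantCoeff_eq_zero A.constantCoeff_arg])
    (by
      -- As `(1 - b x) * A.arg = -x` exactly, the term `g₁ * A.arg` contributes nothing in degree 2.
      have hG : 1 - X + X ^ 3 * (-(1 - C (1 + coeff 1 g) * X) * p ^ 3 * s.subst A.arg) =
          -(1 - C (1 + coeff 1 g) * X) * g.subst A.arg := by
        have hp3 : A.arg ^ 3 = X ^ 3 * p ^ 3 := by rw [hp, mul_pow]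
        have hC : C (1 + coeff 1 g) = 1 + C (coeff 1 g) := by simp
        rw [hgA, hp3]
        rw [hC] at hAX ⊢
        linear_combination C (coeff 1 g) * hAX
      rw [hG]
      linear_combination -(1 - C (1 + coeff 1 g) * X) * hTA - hAX)
    hMw hMX
  have hconj (Y : SubstPair K) (hY : leading Y = (1, -1)) : leading (E * Y * F) = (1, -1) := by
    rw [map_mul, map_mul, mul_right_comm, ← map_mul, hEF, map_one, one_mul, hY]
  have hsq (Y Z : SubstPair K) : E * Y * F * (E * Z * F) = E * (Y * Z) * F := by
    calc _ = E * Y * (F * E) * Z * F := by simp only [mul_assoc]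
      _ = _ := by rw [hFE, mul_one, mul_assoc E]
  refine ⟨A, E * negX * F, E * D * F, hA, hconj _ leading_negX, hconj _ hD, hAA, ?_, ?_, ?_⟩
  · rw [hsq, negX_mul_negX, mul_one, hEF]
  · rw [hsq, hDD, mul_one, hEF]
  · rw [mul_assoc, hsq, ← hNE, mul_assoc (A * T), hEF, mul_one, ← mul_assoc, hAA, one_mul]

end SubstPair

theorem theoremT {K : Type*} [Field K] [CharZero K] (d h : PowerSeries K)
    (hd0 : PowerSeries.coeff 0 d = 1) (hh0 : PowerSeries.coeff 0 h = 0)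
    (hh1 : PowerSeries.coeff 1 h = -1) :
    (riordanMatrix d h ∈ Omega0 K ↔
      PowerSeries.coeff 2 h ^ 2 = PowerSeries.coeff 1 h * PowerSeries.coeff 3 h) ∧
    (riordanMatrix d h ∈ Omega0 K →
      ∃ α β γ δ₁ ω₁ δ₂ ω₂ δ₃ ω₃ : PowerSeries K,
        IsRiordanPair δ₁ ω₁ ∧ IsRiordanPair δ₂ ω₂ ∧ IsRiordanPair δ₃ ω₃ ∧
        IsPlusInvolution α (riordanMatrix δ₁ ω₁) ∧
        IsPlusInvolution β (riordanMatrix δ₂ ω₂) ∧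
        IsPlusInvolution γ (riordanMatrix δ₃ ω₃) ∧
        riordanMatrix d h =
          lowerMul (lowerMul (riordanMatrix δ₁ ω₁) (riordanMatrix δ₂ ω₂))
            (riordanMatrix δ₃ ω₃)) := by
  refine ⟨riordanMatrix_mem_Omega0_iff_coeff hd0 hh0 hh1, fun hΩ => ?_⟩
  obtain ⟨g, -, hg2, hhg⟩ := (riordanMatrix_mem_Omega0_iff hd0).mp hΩ
  obtain ⟨A, B, C, hA, hB, hC, hAA, hBB, hCC, hT⟩ :=
    SubstPair.exists_three_involutions ⟨d, h, by simpa using hh0⟩ hd0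
      (coeffs_of_mul_eq_X hh0 hh1 hhg).1 hg2 hhg
  refine ⟨_, _, _, A.weight, A.arg, B.weight, B.arg, C.weight, C.arg,
    SubstPair.isRiordanPair_of_leading hA, SubstPair.isRiordanPair_of_leading hB,
    SubstPair.isRiordanPair_of_leading hC, SubstPair.isPlusInvolution_of_mul_self hA hAA,
    SubstPair.isPlusInvolution_of_mul_self hB hBB,
    SubstPair.isPlusInvolution_of_mul_self hC hCC, ?_⟩
  have := congrArg SubstPair.toMatrix hT
  rwa [SubstPair.toMatrix_mul, SubstPair.toMatrix_mul] at this
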